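/- Let $R$ be a commutative Noetherian ring with non-zero identity and let $C$ be a semidualizing $R$-module, i.e. a finitely generated $R$-module such that the homothety map $R\to\operatorname{Hom}_R(C,C)$ is an isomorphism and $\operatorname{Ext}^i_R(C,C)=0$ for all $i>0$. Let $\mathcal P_C$ (resp. $\mathcal I_C$) be the class of $R$-modules isomorphic to $C\otimes_R P$ with $P$ projective (resp. to $\operatorname{Hom}_R(C,I)$ with $I$ injective). For an $R$-module $M$ put $$\mathcal P_C\text{-grade}_R(M)=\inf\{i\ge 0\mid \operatorname{Ext}^i_R(M,C\otimes_R P)\ne 0\text{ for some projective }P\},$$ $$\mathcal I_C\text{-grade}_R(M)=\inf\{i\ge 0\mid \operatorname{Ext}^i_R(\operatorname{Hom}_R(C,E),M)\ne 0\text{ for some injective }E\},$$ with $\inf\emptyset=\infty$. Let $C\text{-pd}_R(M)$ be the infimum of $\sup\{k\ge 0\mid X_k\ne 0\}$ over all complexes $X=(\cdots\to X_1\to X_0\to 0)$ of modules in $\mathcal P_C$ with $H_0(X)\cong M$ and $H_k(X)=0$ for $k\ge1$. Dually, let $C\text{-id}_R(M)$ be the infimum of $\sup\{k\ge 0\mid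 X^k\ne 0\}$ over all complexes $X=(0\to X^0\to X^1\to\cdots)$ of modules in $\mathcal I_C$ with $H^0(X)\cong M$ and $H^k(X)=0$ for $k\ge1$. Here $\sup\emptyset=-\infty$ and $\inf\emptyset=\infty$. Let $M$ and $N$ be $R$-modules. In both parts, $n\in\{0,1,2,\dots\}\cup\{\infty\}$, $m\in\{-\infty,0,1,2,\dots\}$, and $i$ runs through the non-negative integers. (i) If $\mathcal I_C\text{-grade}_R(M)=n$ and $C\text{-id}_R(N)=m<n$, then $\operatorname{Ext}^i_R(N,M)=0$ for all $i<n-m$. (ii) If $\mathcal P_C\text{-grade}_R(N)=n$ and $C\text{-pd}_R(M)=m<n$, then $\operatorname{Ext}^i_R(N,M)=0$ for all $i<n-m$. -/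

import Mathlib

open CategoryTheory CategoryTheory.Limits CategoryTheory.Abelian
open scoped TensorProduct

universe u v

namespace RelHom

section Dimensions

variable {R : Type u} [CommRing R]

/-- An `𝒳`-resolution of `M`: a chain complex `⋯ ⟶ X₁ ⟶ X₀ ⟶ 0` of modules in `𝒳`
with `H₀(X) ≅ M` and `Hₙ(X) = 0` for all `n ≥ 1`. -/
structure IsResolution (𝒳 : ObjectProperty (ModuleCat.{v} R)) (M : ModuleCat.{v} R)
    (X : ChainComplex (ModuleCat.{v} R) ℕ) : Prop where
  mem : ∀ n : ℕ, 𝒳 (X.X n)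
  exactAt : ∀ n : ℕ, 1 ≤ n → X.ExactAt n
  homology_zero : Nonempty (X.homology 0 ≅ M)

/-- An `𝒳`-coresolution of `M`: a cochain complex `0 ⟶ X⁰ ⟶ X¹ ⟶ ⋯` of modules in `𝒳`
with `H⁰(X) ≅ M` and `Hⁿ(X) = 0` for all `n ≥ 1`. -/
structure IsCoresolution (𝒳 : ObjectProperty (ModuleCat.{v} R)) (M : ModuleCat.{v} R)
    (X : CochainComplex (ModuleCat.{v} R) ℕ) : Prop where
  mem : ∀ n : ℕ, 𝒳 (X.X n)
  exactAt : ∀ n : ℕ, 1 ≤ n → X.ExactAt n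
  homology_zero : Nonempty (X.homology 0 ≅ M)

/-- The `𝒳`-projective dimension: the infimum, over all `𝒳`-resolutions `X` of `M`, of
`sup {n | Xₙ ≠ 0}`. It is `⊥ = -∞` if `M` is zero (and `𝒳` contains zero),
and `⊤ = ∞` if there is no bounded `𝒳`-resolution. -/
noncomputable def relPd (𝒳 : ObjectProperty (ModuleCat.{v} R)) (M : ModuleCat.{v} R) :
    WithBot ℕ∞ :=
  ⨅ (X : ChainComplex (ModuleCat.{v} R) ℕ) (_ : IsResolution 𝒳 M X),
    ⨆ (n : ℕ) (_ : ¬ IsZero (X.X n)), ((n : ℕ∞) : WithBot ℕ∞)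

/-- The `𝒳`-injective dimension: the infimum, over all `𝒳`-coresolutions `X` of `M`, of
`sup {n | Xⁿ ≠ 0}`. -/
noncomputable def relId (𝒳 : ObjectProperty (ModuleCat.{v} R)) (M : ModuleCat.{v} R) :
    WithBot ℕ∞ :=
  ⨅ (X : CochainComplex (ModuleCat.{v} R) ℕ) (_ : IsCoresolution 𝒳 M X),
    ⨆ (n : ℕ) (_ : ¬ IsZero (X.X n)), ((n : ℕ∞) : WithBot ℕ∞)

/-- The class `𝒫_C` of `C`-projective modules: those isomorphic to `C ⊗ P` with `P`
projective. -/
def cProjective (C : ModuleCat.{v} R) : ObjectProperty (ModuleCat.{v} R) :=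
  fun X => ∃ P : ModuleCat.{v} R, Module.Projective R P ∧ Nonempty (X ≃ₗ[R] C ⊗[R] P)

/-- The class `ℐ_C` of `C`-injective modules: those isomorphic to `Hom(C, I)` with `I`
injective. -/
def cInjective (C : ModuleCat.{v} R) : ObjectProperty (ModuleCat.{v} R) :=
  fun X => ∃ I : ModuleCat.{v} R, Module.Injective R I ∧ Nonempty (X ≃ₗ[R] (C →ₗ[R] I))

/-- `C-pd(M)`. -/
noncomputable def cPd (C M : ModuleCat.{v} R) : WithBot ℕ∞ := relPd (cProjective C) M

/-- `C-id(M)`. -/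
noncomputable def cId (C M : ModuleCat.{v} R) : WithBot ℕ∞ := relId (cInjective C) M

variable [Small.{v} R]

/-- A finitely generated module `C` is semidualizing if the homothety map `R → Hom(C, C)` is
bijective and `Extⁱ(C, C) = 0` for all `i > 0`. -/
structure IsSemidualizing (C : ModuleCat.{v} R) : Prop where
  finite : Module.Finite R C
  homothety_bijective : Function.Bijective (LinearMap.lsmul R C)
  ext_eq_zero : ∀ i : ℕ, 0 < i → Subsingleton (Ext C C i)

/-- `𝒫_C-grade(M) = inf {i | Extⁱ(M, C ⊗ P) ≠ 0 for some projective P}`, which is `⊤` if there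
is no such `i`. -/
noncomputable def pcGrade (C M : ModuleCat.{v} R) : ℕ∞ :=
  ⨅ (i : ℕ) (_ : ∃ P : ModuleCat.{v} R, Module.Projective R P ∧
    Nontrivial (Ext M (ModuleCat.of R (C ⊗[R] P)) i)), (i : ℕ∞)

/-- `ℐ_C-grade(M) = inf {i | Extⁱ(Hom(C, E), M) ≠ 0 for some injective E}`, which is `⊤` if there
is no such `i`. -/
noncomputable def icGrade (C M : ModuleCat.{v} R) : ℕ∞ :=
  ⨅ (i : ℕ) (_ : ∃ E : ModuleCat.{v} R, Module.Injective R E ∧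
    Nontrivial (Ext (ModuleCat.of R (C →ₗ[R] E)) M i)), (i : ℕ∞)

end Dimensions

end RelHom

/-! Dimension shifting. Cut a `C`-injective coresolution of `N` into exact sequences `0 ⟶ Zᵏ ⟶ Xᵏ ⟶
Zᵏ⁺¹ ⟶ 0`, with `Z⁰ ≅ N`. Below the grade, `Ext(Xᵏ, M)` vanishes, so `Extⁱ(Zᵏ, M)` embeds in
`Extⁱ⁺¹(Zᵏ⁺¹, M)`. If `Xʲ = 0`, then `Zʲ = 0`, and the chain from `Extⁱ(N, M)` ends in zero, using
only degrees `i, …, i + j - 1`; with `j = m + 1` these are below `n` exactly when `i + m < n`. Part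
(ii) is dual, with cokernels `Qₖ` in place of cycles: see `subsingleton_ext_cycles` and
`subsingleton_ext_opcycles`. -/

namespace RelHom

section ExtVanishing

variable {A : Type*} [Category* A] [Abelian A]

/-- `0 ⟶ Zᵏ ⟶ Xᵏ ⟶ Zᵏ⁺¹ ⟶ 0` is exact when the complex is exact at `k + 1`. -/
lemma shortExact_cycles (X : CochainComplex A ℕ) (k : ℕ) (h : X.ExactAt (k + 1)) :
    (ShortComplex.mk (X.iCycles k) (X.toCycles k (k + 1))
      (by rw [← cancel_mono (X.iCycles _)]; simp)).ShortExact where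
  exact := by
    refine ShortComplex.exact_of_f_is_kernel _ (KernelFork.IsLimit.ofι' _ _ fun {W} g hg => ?_)
    have hg' : g ≫ X.d k (k + 1) = 0 := by simpa using hg =≫ X.iCycles (k + 1)
    exact ⟨X.liftCycles g (k + 1) (by simp) hg', X.liftCycles_i g (k + 1) (by simp) hg'⟩
  mono_f := by dsimp; infer_instance
  -- The cokernel of `Xᵏ ⟶ Zᵏ⁺¹` is `Hᵏ⁺¹(X)`, which vanishes.
  epi_g := Preadditive.epi_of_isZero_cokernel' _
    (X.homologyIsCokernel k (k + 1) (by simp)) h.isZero_homology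

/-- `0 ⟶ Qₖ₊₁ ⟶ Xₖ ⟶ Qₖ ⟶ 0`, with `Q` the cokernels of the differentials, is exact when the
complex is exact at `k + 1`. -/
lemma shortExact_opcycles (X : ChainComplex A ℕ) (k : ℕ) (h : X.ExactAt (k + 1)) :
    (ShortComplex.mk (X.fromOpcycles (k + 1) k) (X.pOpcycles k)
      (by rw [← cancel_epi (X.pOpcycles _)]; simp)).ShortExact where
  exact := by
    refine ShortComplex.exact_of_g_is_cokernel _
      (CokernelCofork.IsColimit.ofπ' _ _ fun {W} g hg => ?_)
    have hg' : X.d (k + 1) k ≫ g = 0 := by simpa using X.pOpcycles (k + 1) ≫= hg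
    exact ⟨X.descOpcycles g (k + 1) (by simp) hg', X.p_descOpcycles g (k + 1) (by simp) hg'⟩
  mono_f := Preadditive.mono_of_isZero_kernel' _
    (X.homologyIsKernel (k + 1) k (by simp)) h.isZero_homology
  epi_g := by dsimp; infer_instance

variable [HasExt A]

lemma subsingleton_ext_of_isZero_left {X Y : A} (hX : IsZero X) (i : ℕ) :
    Subsingleton (Ext X Y i) := by
  refine subsingleton_of_forall_eq 0 fun e => ?_
  rw [← Ext.mk₀_id_comp e, hX.eq_of_src (𝟙 X) 0, Ext.mk₀_zero, Ext.zero_comp]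

lemma subsingleton_ext_of_isZero_right {X Y : A} (hY : IsZero Y) (i : ℕ) :
    Subsingleton (Ext X Y i) := by
  refine subsingleton_of_forall_eq 0 fun e => ?_
  rw [← Ext.comp_mk₀_id e, hY.eq_of_src (𝟙 Y) 0, Ext.mk₀_zero, Ext.comp_zero]

lemma subsingleton_ext_of_iso_left {X X' Y : A} (f : X ≅ X') (i : ℕ)
    [Subsingleton (Ext X' Y i)] : Subsingleton (Ext X Y i) := by
  refine subsingleton_of_forall_eq 0 fun e => ?_
  rw [← Ext.mk₀_id_comp e, ← f.hom_inv_id, ← Ext.mk₀_comp_mk₀, Ext.comp_assoc_of_second_deg_zero,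
    Subsingleton.elim ((Ext.mk₀ f.inv).comp e _) 0, Ext.comp_zero]

lemma subsingleton_ext_of_iso_right {X Y Y' : A} (f : Y ≅ Y') (i : ℕ)
    [Subsingleton (Ext X Y' i)] : Subsingleton (Ext X Y i) := by
  refine subsingleton_of_forall_eq 0 fun e => ?_
  rw [← Ext.comp_mk₀_id e, ← f.hom_inv_id, ← Ext.mk₀_comp_mk₀,
    ← Ext.comp_assoc_of_second_deg_zero,
    Subsingleton.elim (e.comp (Ext.mk₀ f.hom) _) 0, Ext.zero_comp]

/-- By the long exact sequence, `Extⁱ(S.X₁, Y)` sits between the two groups assumed zero. -/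
lemma subsingleton_ext_X₁ {S : ShortComplex A} (hS : S.ShortExact) {Y : A} (i : ℕ)
    [Subsingleton (Ext S.X₂ Y i)] [Subsingleton (Ext S.X₃ Y (i + 1))] :
    Subsingleton (Ext S.X₁ Y i) := by
  refine subsingleton_of_forall_eq 0 fun e => ?_
  obtain ⟨x, rfl⟩ := Ext.contravariant_sequence_exact₁ hS Y e (add_comm 1 i)
    (Subsingleton.elim _ _)
  rw [Subsingleton.elim x 0, Ext.comp_zero]

lemma subsingleton_ext_X₃ {S : ShortComplex A} (hS : S.ShortExact) {Y : A} (i : ℕ)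
    [Subsingleton (Ext Y S.X₂ i)] [Subsingleton (Ext Y S.X₁ (i + 1))] :
    Subsingleton (Ext Y S.X₃ i) := by
  refine subsingleton_of_forall_eq 0 fun e => ?_
  obtain ⟨x, rfl⟩ := Ext.covariant_sequence_exact₃ Y hS e rfl (Subsingleton.elim _ _)
  rw [Subsingleton.elim x 0, Ext.zero_comp]

/-- Dimension shifting along a bounded coresolution. -/
lemma subsingleton_ext_cycles (X : CochainComplex A ℕ) (Y : A) (n : ℕ∞)
    (hX : ∀ k, 1 ≤ k → X.ExactAt k)
    (hY : ∀ k i : ℕ, (i : ℕ∞) < n → Subsingleton (Ext (X.X k) Y i)) (j : ℕ) :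
    ∀ k i : ℕ, IsZero (X.X (k + j)) → (j = 0 ∨ (i + j : ℕ∞) ≤ n) →
      Subsingleton (Ext (X.cycles k) Y i) := by
  induction j with
  -- `Zᵏ` is a subobject of `Xᵏ = 0`, so no bound on `i` is needed.
  | zero => exact fun k i h _ => subsingleton_ext_of_isZero_left (h.of_mono (X.iCycles k)) i
  | succ j ih =>
    intro k i h hn
    have hn : ((i + 1 + j : ℕ) : ℕ∞) ≤ n := by
      rcases hn with hn | hn
      · omega
      · refine le_trans (le_of_eq ?_) hn
        push_cast; ring
    have : Subsingleton (Ext (X.X k) Y i) :=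
      hY k i (lt_of_lt_of_le (by exact_mod_cast (by omega : i < i + 1 + j)) hn)
    have : Subsingleton (Ext (X.cycles (k + 1)) Y (i + 1)) :=
      ih (k + 1) (i + 1) (by rwa [add_right_comm, add_assoc]) (Or.inr (by exact_mod_cast hn))
    exact subsingleton_ext_X₁ (shortExact_cycles X k (hX _ (by omega))) i

/-- Dimension shifting along a bounded resolution. -/
lemma subsingleton_ext_opcycles (X : ChainComplex A ℕ) (Y : A) (n : ℕ∞)
    (hX : ∀ k, 1 ≤ k → X.ExactAt k)
    (hY : ∀ k i : ℕ, (i : ℕ∞) < n → Subsingleton (Ext Y (X.X k) i)) (j : ℕ) :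
    ∀ k i : ℕ, IsZero (X.X (k + j)) → (j = 0 ∨ (i + j : ℕ∞) ≤ n) →
      Subsingleton (Ext Y (X.opcycles k) i) := by
  induction j with
  | zero => exact fun k i h _ => subsingleton_ext_of_isZero_right (h.of_epi (X.pOpcycles k)) i
  | succ j ih =>
    intro k i h hn
    have hn : ((i + 1 + j : ℕ) : ℕ∞) ≤ n := by
      rcases hn with hn | hn
      · omega
      · refine le_trans (le_of_eq ?_) hn
        push_cast; ring
    have : Subsingleton (Ext Y (X.X k) i) :=
      hY k i (lt_of_lt_of_le (by exact_mod_cast (by omega : i < i + 1 + j)) hn)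
    have : Subsingleton (Ext Y (X.opcycles (k + 1)) (i + 1)) :=
      ih (k + 1) (i + 1) (by rwa [add_right_comm, add_assoc]) (Or.inr (by exact_mod_cast hn))
    exact subsingleton_ext_X₃ (shortExact_opcycles X k (hX _ (by omega))) i

end ExtVanishing

/-- A natural number strictly above `m` that still satisfies the degree bound. -/
lemma exists_nat_bound {m : WithBot ℕ∞} {n : ℕ∞} {i : ℕ}
    (h : ((i : ℕ∞) : WithBot ℕ∞) + m < (n : WithBot ℕ∞)) :
    ∃ j : ℕ, m < ((j : ℕ∞) : WithBot ℕ∞) ∧ (j = 0 ∨ (i + j : ℕ∞) ≤ n) := by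
  induction m with
  -- For `m = -∞` the degree `i` may exceed `n`; the alternative `j = 0` covers this case.
  | bot => exact ⟨0, WithBot.bot_lt_coe _, Or.inl rfl⟩
  | coe m =>
    rw [← WithBot.coe_add, WithBot.coe_lt_coe] at h
    induction m with
    | top => simp at h
    | coe m =>
      refine ⟨m + 1, by rw [WithBot.coe_lt_coe]; exact_mod_cast Nat.lt_succ_self m, Or.inr ?_⟩
      rw [Nat.cast_add, Nat.cast_one, ← add_assoc]
      exact Order.add_one_le_of_lt h

section Modules

variable {R : Type u} [CommRing R]

/-- Some coresolution has supremum below `j`, whereas a nonzero `Xʲ` would make it at least `j`. -/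
lemma exists_isCoresolution_of_relId_lt {𝒳 : ObjectProperty (ModuleCat.{v} R)}
    {N : ModuleCat.{v} R} {j : ℕ} (h : relId 𝒳 N < ((j : ℕ∞) : WithBot ℕ∞)) :
    ∃ X, IsCoresolution 𝒳 N X ∧ IsZero (X.X j) := by
  simp only [relId, iInf_lt_iff] at h
  obtain ⟨X, hX, h⟩ := h
  refine ⟨X, hX, ?_⟩
  by_contra hj
  exact (le_iSup₂_of_le (f := fun (n : ℕ) (_ : ¬ IsZero (X.X n)) => ((n : ℕ∞) : WithBot ℕ∞))
    j hj le_rfl).not_gt h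

lemma exists_isResolution_of_relPd_lt {𝒳 : ObjectProperty (ModuleCat.{v} R)}
    {M : ModuleCat.{v} R} {j : ℕ} (h : relPd 𝒳 M < ((j : ℕ∞) : WithBot ℕ∞)) :
    ∃ X, IsResolution 𝒳 M X ∧ IsZero (X.X j) := by
  simp only [relPd, iInf_lt_iff] at h
  obtain ⟨X, hX, h⟩ := h
  refine ⟨X, hX, ?_⟩
  by_contra hj
  exact (le_iSup₂_of_le (f := fun (n : ℕ) (_ : ¬ IsZero (X.X n)) => ((n : ℕ∞) : WithBot ℕ∞))
    j hj le_rfl).not_gt h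

variable [Small.{v} R]

lemma subsingleton_ext_of_lt_icGrade {C M X : ModuleCat.{v} R} (hX : cInjective C X) {i : ℕ}
    (hi : (i : ℕ∞) < icGrade C M) : Subsingleton (Ext X M i) := by
  obtain ⟨E, hE, ⟨e⟩⟩ := hX
  have : Subsingleton (Ext (ModuleCat.of R (C →ₗ[R] E)) M i) := by
    by_contra h
    exact hi.not_ge (iInf₂_le i ⟨E, hE, not_subsingleton_iff_nontrivial.mp h⟩)
  exact subsingleton_ext_of_iso_left (Y := M) (e.toModuleIso (X₁ := X)) i

lemma subsingleton_ext_of_lt_pcGrade {C N X : ModuleCat.{v} R} (hX : cProjective C X) {i : ℕ}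
    (hi : (i : ℕ∞) < pcGrade C N) : Subsingleton (Ext N X i) := by
  obtain ⟨P, hP, ⟨e⟩⟩ := hX
  have : Subsingleton (Ext N (ModuleCat.of R (C ⊗[R] P)) i) := by
    by_contra h
    exact hi.not_ge (iInf₂_le i ⟨P, hP, not_subsingleton_iff_nontrivial.mp h⟩)
  exact subsingleton_ext_of_iso_right (X := N) (e.toModuleIso (X₁ := X)) i

lemma subsingleton_ext_of_cId_add_lt_icGrade {C M N : ModuleCat.{v} R} {i : ℕ}
    (h : ((i : ℕ∞) : WithBot ℕ∞) + cId C N < (icGrade C M : WithBot ℕ∞)) :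
    Subsingleton (Ext N M i) := by
  obtain ⟨j, hj, hij⟩ := exists_nat_bound h
  obtain ⟨X, hX, h0⟩ := exists_isCoresolution_of_relId_lt hj
  obtain ⟨e⟩ := hX.homology_zero
  have := subsingleton_ext_cycles X M _ hX.exactAt
    (fun k i hi => subsingleton_ext_of_lt_icGrade (hX.mem k) hi) j 0 i (by rwa [zero_add]) hij
  -- No differential enters degree `0`, so `H⁰(X) ≅ Z⁰`.
  exact subsingleton_ext_of_iso_left (e.symm ≪≫ (X.isoHomologyπ _ 0 rfl (by simp)).symm) i

lemma subsingleton_ext_of_cPd_add_lt_pcGrade {C M N : ModuleCat.{v} R} {i : ℕ}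
    (h : ((i : ℕ∞) : WithBot ℕ∞) + cPd C M < (pcGrade C N : WithBot ℕ∞)) :
    Subsingleton (Ext N M i) := by
  obtain ⟨j, hj, hij⟩ := exists_nat_bound h
  obtain ⟨X, hX, h0⟩ := exists_isResolution_of_relPd_lt hj
  obtain ⟨e⟩ := hX.homology_zero
  have := subsingleton_ext_opcycles X N _ hX.exactAt
    (fun k i hi => subsingleton_ext_of_lt_pcGrade (hX.mem k) hi) j 0 i (by rwa [zero_add]) hij
  -- No nonzero differential leaves degree `0`, so `H₀(X) ≅ Q₀`.
  exact subsingleton_ext_of_iso_right (e.symm ≪≫ X.isoHomologyι 0 _ rfl (by simp)) i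

end Modules

end RelHom

/-- The inequality `i + m < n` says `i < n - m`, without truncated subtraction and also when
`n = ∞` or `m = -∞`. -/
theorem theorem3p9 {R : Type u} [CommRing R] [Nontrivial R] [IsNoetherianRing R] [Small.{v} R]
    (C : ModuleCat.{v} R) (hC : RelHom.IsSemidualizing C) (M N : ModuleCat.{v} R) :
    (∀ (n : ℕ∞) (m : WithBot ℕ∞), RelHom.icGrade C M = n → RelHom.cId C N = m →
      m < (n : WithBot ℕ∞) →
      ∀ i : ℕ, ((i : ℕ∞) : WithBot ℕ∞) + m < (n : WithBot ℕ∞) → Subsingleton (Ext N M i)) ∧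
    (∀ (n : ℕ∞) (m : WithBot ℕ∞), RelHom.pcGrade C N = n → RelHom.cPd C M = m →
      m < (n : WithBot ℕ∞) →
      ∀ i : ℕ, ((i : ℕ∞) : WithBot ℕ∞) + m < (n : WithBot ℕ∞) → Subsingleton (Ext N M i)) := by
  constructor
  · rintro _ _ rfl rfl _ i hi
    exact RelHom.subsingleton_ext_of_cId_add_lt_icGrade hi
  · rintro _ _ rfl rfl _ i hi
    exact RelHom.subsingleton_ext_of_cPd_add_lt_pcGrade hi
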